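/- For a complex number $\nu$ that is not a negative integer, let $$j_\nu(z)=\sum_{k=0}^\infty \frac{(-1)^k}{k!\,\Gamma(k+\nu+1)}\left(\frac z2\right)^{2k}\qquad(z\in\mathbb C)$$ be the normalized Bessel function of order $\nu$, i.e. $j_\nu(z)=(z/2)^{-\nu}J_\nu(z)$. A nonzero complex number is called $j_\nu$-rational if it is of the form $a/b$, where $a$ and $b\neq 0$ are zeros of $j_\nu$. A complex number $z$ is called $j_\nu$-Liouville if it is not $j_\nu$-rational and for every $N\in\mathbb N$ there are zeros $a,b$ of $j_\nu$ with $|b|>1$ such that $|z-a/b|<1/|b|^N$. Theorem. For every complex number $\nu$ that is not a negative integer there is a real number $\nu'$ that is not a negative integer such that the set of $j_\nu$-Liouville numbers differs from the set of $j_{\nu'}$-Liouville numbers. Moreover, the $j_{1/2}$-Liouville numbers are exactly the classical Liouville numbers, i.e. the real numbers $x$ such that for every $n\in\mathbb N$ there are integers $p,q$ with $q>1$ and $0<|x-p/q|<1/q^n$. Hence there is a real number $\nu'$, not a negative integer, for which the set of $j_{\nu'}$-Liouville numbers is not the set of classical Liouville numbers. -/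

import Mathlib

/-- The normalized Bessel function `j_ν(z) = (z/2)^{-ν} J_ν(z)` of complex order `ν`, the entire
function of `z` given by its everywhere absolutely convergent power series
`∑ (-1)^k / (k! Γ(k + ν + 1)) (z/2)^{2k}`. Mathlib's `Complex.Gamma` is `0` at the poles of the
Gamma function, so the coefficient is `0` there, as it has to be. -/
noncomputable def besselj (ν z : ℂ) : ℂ :=
  ∑' k : ℕ, (-1 : ℂ) ^ k / ((k.factorial : ℂ) * Complex.Gamma ((k : ℂ) + ν + 1)) *
    (z / 2) ^ (2 * k)

/-- A nonzero complex number is `j_ν`-rational if it is a quotient of two zeros of `j_ν`. -/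
def IsBesselRational (ν z : ℂ) : Prop :=
  z ≠ 0 ∧ ∃ a b : ℂ, besselj ν a = 0 ∧ besselj ν b = 0 ∧ b ≠ 0 ∧ z = a / b

/-- A complex number `z` is `j_ν`-Liouville if it is not `j_ν`-rational and for every natural
number `N` there are zeros `a`, `b` of `j_ν` with `|b| > 1` and `|z - a / b| < 1 / |b| ^ N`. -/
def IsBesselLiouville (ν z : ℂ) : Prop :=
  ¬ IsBesselRational ν z ∧
    ∀ N : ℕ, ∃ a b : ℂ, besselj ν a = 0 ∧ besselj ν b = 0 ∧ 1 < ‖b‖ ∧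
      ‖z - a / b‖ < 1 / ‖b‖ ^ N

/-- The set of `j_ν`-Liouville numbers, a subset of `ℂ`. -/
def besselLiouvilleSet (ν : ℂ) : Set ℂ := {z | IsBesselLiouville ν z}

/-- The set of classical Liouville numbers (real numbers), regarded as a subset of `ℂ`. -/
def classicalLiouvilleSet : Set ℂ := (fun x : ℝ => (x : ℂ)) '' {x : ℝ | Liouville x}

open Filter Topology Set

/-! ### The case of order one half -/

/-! Since `z * j_{1/2}(z)` is a constant multiple of `sin z`, the zeros of `j_{1/2}` are the nonzero
multiples of `π`. Their quotients are the nonzero rationals, and the factor `π` in the denominators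
is absorbed by changing the exponent; this gives `besselLiouvilleSet_half`.

It then suffices to find one real order whose set is not classical: any `ν` differs from that order
or from `1/2`. Put `ν' = μ - 1` and `w = (z/2)^2`. As `μ → 0+`, one zero in `w` tends to `0` while
another stays between `1/3` and `5`, so the ratios of zeros take all small positive values
(`eventually_exists_reducedBessel_eq_zero`). Choosing the ratio to be a classical Liouville number
makes that number `j_{ν'}`-rational, hence not `j_{ν'}`-Liouville. -/

theorem factorial_mul_Gamma_add_three_halves (k : ℕ) :
    (k.factorial : ℂ) * Complex.Gamma (k + 1 / 2 + 1) =
      (2 * k + 1).factorial * (2 : ℂ)⁻¹ ^ (2 * k + 1) * (√Real.pi : ℝ) := by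
  have h := Complex.Gamma_mul_Gamma_add_half ((k : ℂ) + 1)
  rw [Complex.Gamma_nat_eq_factorial] at h
  have e1 : (k : ℂ) + 1 + 1 / 2 = k + 1 / 2 + 1 := by ring
  have e2 : 2 * ((k : ℂ) + 1) = ((2 * k + 1 : ℕ) : ℂ) + 1 := by push_cast; ring
  have e3 : (2 : ℂ) ^ (1 - (((2 * k + 1 : ℕ) : ℂ) + 1)) = (2 : ℂ)⁻¹ ^ (2 * k + 1) := by
    rw [show 1 - (((2 * k + 1 : ℕ) : ℂ) + 1) = -((2 * k + 1 : ℕ) : ℂ) by ring,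
      Complex.cpow_neg, Complex.cpow_natCast, inv_pow]
  rw [e1, e2, Complex.Gamma_nat_eq_factorial, e3] at h
  exact h

theorem mul_besselj_half (z : ℂ) :
    z * besselj (1 / 2) z = 2 / (√Real.pi : ℝ) * Complex.sin z := by
  have hpi : ((√Real.pi : ℝ) : ℂ) ≠ 0 := by
    exact_mod_cast (Real.sqrt_pos.2 Real.pi_pos).ne'
  rw [besselj, ← tsum_mul_left, ← (Complex.hasSum_sin z).tsum_eq, ← tsum_mul_left]
  refine tsum_congr fun k => ?_
  rw [factorial_mul_Gamma_add_three_halves]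
  have : ((2 * k + 1).factorial : ℂ) ≠ 0 := by exact_mod_cast Nat.factorial_ne_zero _
  rw [div_pow, inv_pow]
  field_simp
  ring

theorem besselj_half_zero_ne_zero : besselj (1 / 2) 0 ≠ 0 := by
  rw [besselj, tsum_eq_single 0]
  · simp only [pow_zero, Nat.factorial_zero, Nat.cast_one, Nat.cast_zero, mul_zero, mul_one,
      one_mul]
    exact one_div_ne_zero (Complex.Gamma_ne_zero_of_re_pos (by norm_num))
  · intro k hk
    simp [hk]

theorem besselj_half_eq_zero_iff (z : ℂ) :
    besselj (1 / 2) z = 0 ↔ ∃ n : ℤ, n ≠ 0 ∧ z = n * Real.pi := by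
  have hpi : ((√Real.pi : ℝ) : ℂ) ≠ 0 := by
    exact_mod_cast (Real.sqrt_pos.2 Real.pi_pos).ne'
  have hpi' : (Real.pi : ℂ) ≠ 0 := by exact_mod_cast Real.pi_ne_zero
  have h := mul_besselj_half z
  constructor
  · intro hz
    rw [hz, mul_zero, eq_comm, mul_eq_zero, or_iff_right (div_ne_zero two_ne_zero hpi),
      Complex.sin_eq_zero_iff] at h
    obtain ⟨n, rfl⟩ := h
    refine ⟨n, ?_, rfl⟩
    rintro rfl
    apply besselj_half_zero_ne_zero
    simpa using hz
  · rintro ⟨n, hn, rfl⟩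
    rw [Complex.sin_int_mul_pi, mul_zero, mul_eq_zero] at h
    exact h.resolve_left (mul_ne_zero (by exact_mod_cast hn) hpi')

theorem isBesselRational_half_iff (z : ℂ) :
    IsBesselRational (1 / 2) z ↔ ∃ m n : ℤ, m ≠ 0 ∧ n ≠ 0 ∧ z = m / n := by
  have hpi' : (Real.pi : ℂ) ≠ 0 := by exact_mod_cast Real.pi_ne_zero
  simp only [IsBesselRational, besselj_half_eq_zero_iff]
  constructor
  · rintro ⟨-, _, _, ⟨m, hm, rfl⟩, ⟨n, hn, rfl⟩, -, rfl⟩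
    exact ⟨m, n, hm, hn, mul_div_mul_right _ _ hpi'⟩
  · rintro ⟨m, n, hm, hn, rfl⟩
    have hm' : (m : ℂ) ≠ 0 := by exact_mod_cast hm
    have hn' : (n : ℂ) ≠ 0 := by exact_mod_cast hn
    exact ⟨div_ne_zero hm' hn', _, _, ⟨m, hm, rfl⟩, ⟨n, hn, rfl⟩, mul_ne_zero hn' hpi',
      (mul_div_mul_right _ _ hpi').symm⟩

theorem norm_intCast_mul_pi (n : ℤ) : ‖(n : ℂ) * Real.pi‖ = |(n : ℝ)| * Real.pi := by
  rw [norm_mul, Complex.norm_intCast, Complex.norm_real, Real.norm_eq_abs,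
    abs_of_pos Real.pi_pos]

theorem isBesselLiouville_half_iff (z : ℂ) :
    IsBesselLiouville (1 / 2) z ↔ (∀ m n : ℤ, m ≠ 0 → n ≠ 0 → z ≠ m / n) ∧
      ∀ N : ℕ, ∃ m n : ℤ, m ≠ 0 ∧ n ≠ 0 ∧
        ‖z - m / n‖ < 1 / (|(n : ℝ)| * Real.pi) ^ N := by
  have hpi' : (Real.pi : ℂ) ≠ 0 := by exact_mod_cast Real.pi_ne_zero
  rw [IsBesselLiouville, isBesselRational_half_iff]
  simp only [besselj_half_eq_zero_iff]
  refine and_congr ⟨fun h m n hm hn hz => h ⟨m, n, hm, hn, hz⟩,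
    fun h ⟨m, n, hm, hn, hz⟩ => h m n hm hn hz⟩ (forall_congr' fun N => ?_)
  constructor
  · rintro ⟨_, _, ⟨m, hm, rfl⟩, ⟨n, hn, rfl⟩, -, h⟩
    rw [mul_div_mul_right _ _ hpi', norm_intCast_mul_pi] at h
    exact ⟨m, n, hm, hn, h⟩
  · rintro ⟨m, n, hm, hn, h⟩
    refine ⟨_, _, ⟨m, hm, rfl⟩, ⟨n, hn, rfl⟩, ?_, ?_⟩
    · rw [norm_intCast_mul_pi]
      have : (1 : ℝ) ≤ |(n : ℝ)| := by exact_mod_cast Int.one_le_abs hn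
      nlinarith [Real.pi_gt_three]
    · rwa [mul_div_mul_right _ _ hpi', norm_intCast_mul_pi]

/-- All approximants are real, so none comes closer than `|Im z|`, while the error bound is at most
`2^{-N}`. -/
theorem im_eq_zero_of_isBesselLiouville_half {z : ℂ} (hz : IsBesselLiouville (1 / 2) z) :
    z.im = 0 := by
  rw [isBesselLiouville_half_iff] at hz
  by_contra him
  have h0 : 0 < |z.im| := abs_pos.2 him
  obtain ⟨N, hN⟩ := exists_pow_lt_of_lt_one h0 (show (1 / 2 : ℝ) < 1 by norm_num)
  obtain ⟨m, n, -, hn, h⟩ := hz.2 N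
  have hn1 : (1 : ℝ) ≤ |(n : ℝ)| := by exact_mod_cast Int.one_le_abs hn
  have h1 : |z.im| ≤ ‖z - m / n‖ := by
    have := Complex.abs_im_le_norm (z - m / n)
    rwa [Complex.sub_im, show ((m : ℂ) / n).im = 0 by
      rw [show (m : ℂ) / n = ((m / n : ℝ) : ℂ) by push_cast; rfl, Complex.ofReal_im],
      sub_zero] at this
  have h2 : 1 / (|(n : ℝ)| * Real.pi) ^ N ≤ (1 / 2 : ℝ) ^ N := by
    rw [one_div_pow]
    gcongr
    nlinarith [Real.pi_gt_three]
  linarith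

theorem liouville_of_isBesselLiouville_half {x : ℝ} (hx : IsBesselLiouville (1 / 2) (x : ℂ)) :
    Liouville x := by
  rw [isBesselLiouville_half_iff] at hx
  have hcast : ∀ m n : ℤ, ((x : ℂ) - m / n) = ((x - m / n : ℝ) : ℂ) := fun m n => by push_cast; rfl
  intro N
  obtain ⟨m, n, hm, hn, h⟩ := hx.2 N
  have hn1 : (1 : ℝ) ≤ |(n : ℝ)| := by exact_mod_cast Int.one_le_abs hn
  have hnR : (n : ℝ) ≠ 0 := by exact_mod_cast hn
  have hn1' : 1 ≤ |n| := Int.one_le_abs hn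
  have key : ((2 * m * n.sign : ℤ) : ℝ) / ((2 * |n| : ℤ) : ℝ) = m / n := by
    rcases lt_or_gt_of_ne hn with h | h
    · rw [Int.sign_eq_neg_one_of_neg h, abs_of_neg h]
      push_cast
      field_simp
    · rw [Int.sign_eq_one_of_pos h, abs_of_pos h]
      push_cast
      field_simp
  -- Doubling makes the denominator exceed `1` even when `|n| = 1`; it is harmless because `2 ≤ π`.
  refine ⟨2 * m * n.sign, 2 * |n|, by linarith, ?_, ?_⟩
  · rw [key]
    intro hxe
    apply hx.1 m n hm hn
    rw [hxe]
    push_cast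
    rfl
  · rw [key]
    rw [hcast, Complex.norm_real, Real.norm_eq_abs] at h
    refine h.trans_le ?_
    have hle : 2 * |(n : ℝ)| ≤ |(n : ℝ)| * Real.pi := by nlinarith [Real.pi_gt_three]
    push_cast
    exact one_div_le_one_div_of_le (by positivity) (pow_le_pow_left₀ (by positivity) hle N)

theorem isBesselLiouville_half_of_liouville {x : ℝ} (hx : Liouville x) :
    IsBesselLiouville (1 / 2) (x : ℂ) := by
  have hcast : ∀ m n : ℤ, ((x : ℂ) - m / n) = ((x - m / n : ℝ) : ℂ) := fun m n => by push_cast; rfl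
  rw [isBesselLiouville_half_iff]
  constructor
  · intro m n _ _ h
    apply hx.irrational
    refine ⟨(m : ℚ) / n, ?_⟩
    have : (x : ℂ) = ((m / n : ℝ) : ℂ) := by rw [h]; push_cast; rfl
    push_cast
    exact (Complex.ofReal_injective this).symm
  · intro N
    have h0 : 0 < |x| := abs_pos.2 hx.irrational.ne_zero
    obtain ⟨K, hK⟩ := exists_pow_lt_of_lt_one h0 (show (1 / 2 : ℝ) < 1 by norm_num)
    -- `3 * N` pays for `π`, as `b * π ≤ b ^ 3`; `K` excludes `a = 0`, which is not allowed because
    -- `0` is not a zero of `j_{1/2}`.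
    obtain ⟨a, b, hb, hne, hlt⟩ := hx (3 * N + K)
    have hb2 : (2 : ℝ) ≤ b := by exact_mod_cast hb
    have hb0 : (0 : ℝ) < b := by linarith
    refine ⟨a, b, ?_, by linarith, ?_⟩
    · rintro rfl
      rw [Int.cast_zero, zero_div, sub_zero] at hlt
      have : 1 / (b : ℝ) ^ (3 * N + K) ≤ (1 / 2 : ℝ) ^ K := by
        rw [one_div_pow]
        apply one_div_le_one_div_of_le (by positivity)
        calc (2 : ℝ) ^ K ≤ b ^ K := by gcongr
          _ ≤ b ^ (3 * N + K) := pow_le_pow_right₀ (by linarith) (by omega)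
      linarith
    · rw [hcast, Complex.norm_real, Real.norm_eq_abs]
      refine hlt.trans_le ?_
      rw [abs_of_pos hb0]
      apply one_div_le_one_div_of_le (pow_pos (mul_pos hb0 Real.pi_pos) _)
      calc ((b : ℝ) * Real.pi) ^ N ≤ ((b : ℝ) ^ 3) ^ N := by
            refine pow_le_pow_left₀ (mul_pos hb0 Real.pi_pos).le ?_ _
            have : Real.pi ≤ (b : ℝ) ^ 2 := by nlinarith [Real.pi_le_four]
            nlinarith
        _ = (b : ℝ) ^ (3 * N) := (pow_mul _ _ _).symm
        _ ≤ (b : ℝ) ^ (3 * N + K) := pow_le_pow_right₀ (by linarith) (by omega)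

theorem besselLiouvilleSet_half : besselLiouvilleSet (1 / 2) = classicalLiouvilleSet := by
  ext z
  constructor
  · intro hz
    have him := im_eq_zero_of_isBesselLiouville_half hz
    have hre : ((z.re : ℝ) : ℂ) = z := Complex.ext rfl him.symm
    refine ⟨z.re, liouville_of_isBesselLiouville_half ?_, hre⟩
    rwa [hre]
  · rintro ⟨x, hx, rfl⟩
    exact isBesselLiouville_half_of_liouville hx

/-! ### Zeros of Bessel functions of order slightly above `-1` -/

/-- The coefficient `1 / ((k + 1)! (1 + μ) (2 + μ) ⋯ (k + μ))`. -/
noncomputable def reducedBesselCoeff (μ : ℝ) (k : ℕ) : ℝ :=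
  1 / ((k + 1).factorial * ∏ i ∈ Finset.range k, ((i : ℝ) + 1 + μ))

/-- The series `∑ (-w)^k / ((k + 1)! (1 + μ) ⋯ (k + μ))`. -/
noncomputable def reducedBesselSeries (w μ : ℝ) : ℝ :=
  ∑' k : ℕ, (-w) ^ k * reducedBesselCoeff μ k

/-- The function `Γ(μ + 1) j_{μ - 1}(2 √w)`, see `Gamma_mul_besselj`. -/
noncomputable def reducedBessel (w μ : ℝ) : ℝ := μ - w * reducedBesselSeries w μ

theorem reducedBesselCoeff_zero_index (μ : ℝ) : reducedBesselCoeff μ 0 = 1 := by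
  simp [reducedBesselCoeff]

theorem reducedBesselCoeff_succ (μ : ℝ) (k : ℕ) : reducedBesselCoeff μ (k + 1) =
    reducedBesselCoeff μ k / ((k + 2) * (k + 1 + μ)) := by
  rw [reducedBesselCoeff, reducedBesselCoeff, Finset.prod_range_succ, Nat.factorial_succ (k + 1)]
  rw [div_div]
  push_cast
  congr 1
  ring

theorem reducedBesselCoeff_pos {μ : ℝ} (hμ : 0 ≤ μ) (k : ℕ) : 0 < reducedBesselCoeff μ k := by
  rw [reducedBesselCoeff]
  have : 0 < ∏ i ∈ Finset.range k, ((i : ℝ) + 1 + μ) := Finset.prod_pos fun i _ => by positivity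
  positivity

theorem one_le_prod_range_add {μ : ℝ} (hμ : 0 ≤ μ) (k : ℕ) :
    1 ≤ ∏ i ∈ Finset.range k, ((i : ℝ) + 1 + μ) := by
  induction k with
  | zero => simp
  | succ k ih =>
    rw [Finset.prod_range_succ]
    have : (0 : ℝ) ≤ k := by positivity
    nlinarith

theorem reducedBesselCoeff_le {μ : ℝ} (hμ : 0 ≤ μ) (k : ℕ) :
    reducedBesselCoeff μ k ≤ 1 / (k + 1).factorial := by
  rw [reducedBesselCoeff]
  have h : (0 : ℝ) < (k + 1).factorial := by positivity
  exact one_div_le_one_div_of_le h (le_mul_of_one_le_right h.le (one_le_prod_range_add hμ k))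

theorem reducedBesselCoeff_le_factorial {μ : ℝ} (hμ : 0 ≤ μ) (k : ℕ) :
    reducedBesselCoeff μ k ≤ 1 / k.factorial :=
  (reducedBesselCoeff_le hμ k).trans <|
    one_div_le_one_div_of_le (by positivity) (by exact_mod_cast Nat.factorial_le k.le_succ)

theorem reducedBesselCoeff_le_half {μ : ℝ} (hμ : 0 ≤ μ) (k : ℕ) :
    reducedBesselCoeff μ (k + 1) ≤ 1 / 2 :=
  (reducedBesselCoeff_le hμ _).trans <|
    one_div_le_one_div_of_le (by positivity)
      (by exact_mod_cast Nat.factorial_le (show 2 ≤ k + 1 + 1 by omega))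

theorem abs_reducedBessel_term_le {w W μ : ℝ} (hw : 0 ≤ w) (hW : w ≤ W) (hμ : 0 ≤ μ) (k : ℕ) :
    ‖(-w) ^ k * reducedBesselCoeff μ k‖ ≤ W ^ k / k.factorial := by
  rw [norm_mul, norm_pow, norm_neg, Real.norm_of_nonneg hw,
    Real.norm_of_nonneg (reducedBesselCoeff_pos hμ k).le, div_eq_mul_one_div]
  exact mul_le_mul (pow_le_pow_left₀ hw hW k) (reducedBesselCoeff_le_factorial hμ k)
    (reducedBesselCoeff_pos hμ k).le (pow_nonneg (hw.trans hW) k)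

theorem summable_reducedBessel {w μ : ℝ} (hw : 0 ≤ w) (hμ : 0 ≤ μ) :
    Summable fun k : ℕ => (-w) ^ k * reducedBesselCoeff μ k :=
  .of_norm_bounded (Real.summable_pow_div_factorial w)
    fun k => abs_reducedBessel_term_le hw le_rfl hμ k

theorem continuousOn_reducedBessel :
    ContinuousOn (fun p : ℝ × ℝ => reducedBessel p.1 p.2) (Ici 0 ×ˢ Ici 0) := by
  have hloc : ∀ W : ℝ, ContinuousOn (fun p : ℝ × ℝ => reducedBesselSeries p.1 p.2)
      (Icc 0 W ×ˢ Ici 0) := by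
    intro W
    refine continuousOn_tsum (fun k => ?_) (Real.summable_pow_div_factorial W)
      fun k p hp => abs_reducedBessel_term_le hp.1.1 hp.1.2 hp.2 k
    simp only [reducedBesselCoeff]
    refine ContinuousOn.mul (by fun_prop) (ContinuousOn.div (by fun_prop) (by fun_prop) ?_)
    rintro p ⟨-, hp⟩
    have := one_le_prod_range_add (mem_Ici.1 hp) k
    positivity
  have hseries : ContinuousOn (fun p : ℝ × ℝ => reducedBesselSeries p.1 p.2)
      (Ici 0 ×ˢ Ici 0) := by
    rintro ⟨w, μ⟩ ⟨hw, hμ⟩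
    have h := hloc (w + 1) (w, μ) ⟨⟨hw, by simp⟩, hμ⟩
    refine h.mono_of_mem_nhdsWithin ?_
    have : Iio (w + 1) ×ˢ (univ : Set ℝ) ∈ 𝓝 (w, μ) :=
      prod_mem_nhds (Iio_mem_nhds (by simp)) univ_mem
    filter_upwards [mem_nhdsWithin_of_mem_nhds this, self_mem_nhdsWithin] with p hp hp'
    exact ⟨⟨hp'.1, hp.1.le⟩, hp'.2⟩
  exact continuousOn_snd.sub (continuousOn_fst.mul hseries)

/-- In the recursion, half of the previous difference plus half of `μ' - μ` bounds the new
difference, so the Lipschitz constant `1` persists. -/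
theorem reducedBesselCoeff_sub_mem {μ μ' : ℝ} (hμ : 0 ≤ μ) (h : μ ≤ μ') (k : ℕ) :
    |reducedBesselCoeff μ k - reducedBesselCoeff μ' k| ≤ μ' - μ := by
  suffices 0 ≤ reducedBesselCoeff μ k - reducedBesselCoeff μ' k ∧
      reducedBesselCoeff μ k - reducedBesselCoeff μ' k ≤ μ' - μ from
    abs_le.2 ⟨by linarith, this.2⟩
  induction k with
  | zero => simp [reducedBesselCoeff_zero_index, h]
  | succ k ih =>
    rw [reducedBesselCoeff_succ, reducedBesselCoeff_succ]
    have hk : (0 : ℝ) ≤ k := by positivity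
    set D := reducedBesselCoeff μ k
    set E := reducedBesselCoeff μ' k
    have hE : 0 < E := reducedBesselCoeff_pos (hμ.trans h) k
    have hE1 : E ≤ 1 := (reducedBesselCoeff_le_factorial (hμ.trans h) k).trans
      (div_le_self zero_le_one (by exact_mod_cast Nat.one_le_iff_ne_zero.2 k.factorial_ne_zero))
    have hA : (2 : ℝ) ≤ (k + 2) * (k + 1 + μ) := by nlinarith
    have hB : (2 : ℝ) ≤ (k + 2) * (k + 1 + μ') := by nlinarith
    have hAB : (k + 2) * (k + 1 + μ) ≤ (k + 2) * (k + 1 + μ') := by gcongr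
    have e : D / ((k + 2) * (k + 1 + μ)) - E / ((k + 2) * (k + 1 + μ')) =
        (D - E) / ((k + 2) * (k + 1 + μ)) +
          E * (μ' - μ) / ((k + 2) * (k + 1 + μ) * (k + 1 + μ')) := by
      have : (k : ℝ) + 1 + μ ≠ 0 := by positivity
      have : (k : ℝ) + 1 + μ' ≠ 0 := by have := hμ.trans h; positivity
      field_simp
      ring
    have hden : (2 : ℝ) ≤ (k + 2) * (k + 1 + μ) * (k + 1 + μ') := by nlinarith
    have hn : 0 ≤ E * (μ' - μ) := mul_nonneg hE.le (sub_nonneg.2 h)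
    rw [e]
    constructor
    · exact add_nonneg (div_nonneg ih.1 (by linarith)) (div_nonneg hn (by linarith))
    · have h1 : (D - E) / ((k + 2) * (k + 1 + μ)) ≤ (D - E) / 2 :=
        div_le_div_of_nonneg_left ih.1 two_pos hA
      have h2 : E * (μ' - μ) / ((k + 2) * (k + 1 + μ) * (k + 1 + μ')) ≤ E * (μ' - μ) / 2 :=
        div_le_div_of_nonneg_left hn two_pos hden
      have h3 : E * (μ' - μ) ≤ μ' - μ := mul_le_of_le_one_left (sub_nonneg.2 h) hE1
      linarith [ih.2]

theorem abs_reducedBesselSeries_sub_one_le {y μ : ℝ} (hy : 0 ≤ y) (hy' : y ≤ 1 / 3) (hμ : 0 ≤ μ) :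
    |reducedBesselSeries y μ - 1| ≤ 1 / 4 := by
  have hs := summable_reducedBessel hy hμ
  rw [reducedBesselSeries, hs.tsum_eq_zero_add, reducedBesselCoeff_zero_index]
  simp only [pow_zero, mul_one, add_sub_cancel_left]
  have hg : HasSum (fun k : ℕ => (1 / 6 : ℝ) * (1 / 3) ^ k) (1 / 4) := by
    have := (hasSum_geometric_of_lt_one (r := (1 / 3 : ℝ)) (by norm_num) (by norm_num)).mul_left
      (1 / 6)
    norm_num at this ⊢
    exact this
  rw [← Real.norm_eq_abs]
  refine tsum_of_norm_bounded hg fun k => ?_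
  rw [norm_mul, norm_pow, norm_neg, Real.norm_of_nonneg hy,
    Real.norm_of_nonneg (reducedBesselCoeff_pos hμ _).le]
  calc y ^ (k + 1) * reducedBesselCoeff μ (k + 1) ≤ (1 / 3) ^ (k + 1) * (1 / 2) :=
        mul_le_mul (by gcongr) (reducedBesselCoeff_le_half hμ k)
          (reducedBesselCoeff_pos hμ _).le (by positivity)
    _ = 1 / 6 * (1 / 3) ^ k := by ring

theorem abs_reducedBesselSeries_sub_le {y μ μ' : ℝ} (hy : 0 ≤ y) (hy' : y ≤ 1 / 3) (hμ : 0 ≤ μ)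
    (h : μ ≤ μ') :
    |reducedBesselSeries y μ' - reducedBesselSeries y μ| ≤ 3 / 2 * (μ' - μ) := by
  rw [reducedBesselSeries, reducedBesselSeries,
    ← (summable_reducedBessel hy (hμ.trans h)).tsum_sub (summable_reducedBessel hy hμ)]
  have hg : HasSum (fun k : ℕ => (1 / 3 : ℝ) ^ k * (μ' - μ)) (3 / 2 * (μ' - μ)) := by
    have := (hasSum_geometric_of_lt_one (r := (1 / 3 : ℝ)) (by norm_num) (by norm_num)).mul_right
      (μ' - μ)
    norm_num at this ⊢
    exact this
  rw [← Real.norm_eq_abs]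
  refine tsum_of_norm_bounded hg fun k => ?_
  rw [← mul_sub, norm_mul, norm_pow, norm_neg, Real.norm_of_nonneg hy, norm_sub_rev]
  gcongr
  exact reducedBesselCoeff_sub_mem hμ h k

/-- The linear term `μ` wins: the series part varies by at most `1/3 * 3/2 = 1/2` of the increment.
-/
theorem strictMonoOn_reducedBessel {y : ℝ} (hy : 0 ≤ y) (hy' : y ≤ 1 / 3) :
    StrictMonoOn (reducedBessel y) (Ici 0) := by
  intro μ hμ μ' _ h
  have := (abs_le.1 (abs_reducedBesselSeries_sub_le hy hy' hμ h.le)).2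
  have h1 : y * (reducedBesselSeries y μ' - reducedBesselSeries y μ) ≤
      1 / 3 * (3 / 2 * (μ' - μ)) := by
    calc _ ≤ y * (3 / 2 * (μ' - μ)) := by gcongr
      _ ≤ _ := by
        have := sub_pos.2 h
        gcongr
  simp only [reducedBessel]
  linarith

theorem exists_reducedBessel_eq_zero {y : ℝ} (hy : 0 ≤ y) (hy' : y ≤ 1 / 3) :
    ∃ μ ∈ Icc (0 : ℝ) 1, reducedBessel y μ = 0 := by
  have hc : ContinuousOn (reducedBessel y) (Icc 0 1) :=
    continuousOn_reducedBessel.comp (f := fun μ : ℝ => (y, μ)) (by fun_prop)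
      fun μ hμ => ⟨hy, hμ.1⟩
  have h0 := abs_le.1 (abs_reducedBesselSeries_sub_one_le hy hy' le_rfl)
  have h1 := abs_le.1 (abs_reducedBesselSeries_sub_one_le hy hy' zero_le_one)
  refine intermediate_value_Icc zero_le_one hc ⟨?_, ?_⟩
  · simp only [reducedBessel]
    nlinarith
  · simp only [reducedBessel]
    nlinarith

/-- The preimage of a closed set is a projection of a closed set along a compact factor. This yields
continuity of a unique root without derivatives. -/
theorem continuous_of_isClosed_graph {X Y : Type*} [TopologicalSpace X] [TopologicalSpace Y]
    [CompactSpace Y] {f : X → Y} (hf : IsClosed {p : X × Y | p.2 = f p.1}) : Continuous f := by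
  refine continuous_iff_isClosed.2 fun C hC => ?_
  have : f ⁻¹' C = Prod.fst '' ({p : X × Y | p.2 = f p.1} ∩ Prod.snd ⁻¹' C) := by
    ext x
    constructor
    · intro hx
      exact ⟨(x, f x), ⟨rfl, hx⟩, rfl⟩
    · rintro ⟨⟨x, y⟩, ⟨hp, hy⟩, rfl⟩
      simp only [mem_ofPred_eq] at hp
      subst hp
      exact hy
  rw [this]
  exact isClosedMap_fst_of_compactSpace _ (hf.inter (hC.preimage continuous_snd))

/-- A continuous branch `μ = m(y)` of solutions of `reducedBessel y μ = 0` near `(0, 0)`. -/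
theorem exists_continuous_reducedBessel_eq_zero :
    ∃ m : ℝ → ℝ, Continuous m ∧ m 0 = 0 ∧
      ∀ y ∈ Icc (0 : ℝ) (1 / 3), 0 ≤ m y ∧ reducedBessel y (m y) = 0 := by
  choose f hf hf0 using fun y : Icc (0 : ℝ) (1 / 3) => exists_reducedBessel_eq_zero y.2.1 y.2.2
  let g : Icc (0 : ℝ) (1 / 3) → Icc (0 : ℝ) 1 := fun y => ⟨f y, hf y⟩
  have hg : Continuous g := by
    apply continuous_of_isClosed_graph
    have hset : {p : Icc (0 : ℝ) (1 / 3) × Icc (0 : ℝ) 1 | p.2 = g p.1} =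
        {p | reducedBessel p.1 p.2 = 0} := by
      ext ⟨y, μ⟩
      simp only [mem_ofPred_eq]
      constructor
      · rintro rfl
        exact hf0 y
      · intro h
        exact Subtype.ext ((strictMonoOn_reducedBessel y.2.1 y.2.2).injOn μ.2.1 (hf y).1
          (h.trans (hf0 y).symm))
    rw [hset]
    refine isClosed_eq ?_ continuous_const
    exact continuousOn_reducedBessel.comp_continuous
      (f := fun p : Icc (0 : ℝ) (1 / 3) × Icc (0 : ℝ) 1 => ((p.1 : ℝ), (p.2 : ℝ)))
      (by fun_prop) fun p => ⟨p.1.2.1, p.2.2.1⟩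
  have h3 : (0 : ℝ) ≤ 1 / 3 := by norm_num
  have hext : ∀ y (hy : y ∈ Icc (0 : ℝ) (1 / 3)),
      ((IccExtend h3 g y : Icc (0 : ℝ) 1) : ℝ) = f ⟨y, hy⟩ := fun y hy => by
    rw [IccExtend_of_mem h3 g hy]
  refine ⟨fun y => (IccExtend h3 g y : Icc (0 : ℝ) 1), by fun_prop, ?_, fun y hy => ?_⟩
  · have h0 : (0 : ℝ) ∈ Icc (0 : ℝ) (1 / 3) := ⟨le_rfl, h3⟩
    have := hf0 ⟨0, h0⟩
    simp only [reducedBessel, zero_mul, sub_zero] at this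
    exact (hext 0 h0).trans this
  · simp only [hext y hy]
    exact ⟨(hf _).1, hf0 _⟩

theorem reducedBessel_zero_right_neg {y : ℝ} (hy : 0 < y) (hy' : y ≤ 1 / 3) :
    reducedBessel y 0 < 0 := by
  have h0 := abs_le.1 (abs_reducedBesselSeries_sub_one_le hy.le hy' le_rfl)
  simp only [reducedBessel]
  nlinarith

/-- At `μ = 0` the function is `-√w J_1(2√w)`, and `2√5` lies just beyond the first positive zero of
`J_1`. Six terms sum to less than `-1/10`; the tail is at most `e^5 / 7! < 243 / 5040`. -/
theorem reducedBessel_five_zero_pos : 0 < reducedBessel 5 0 := by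
  have hs := summable_reducedBessel (w := 5) (by norm_num) (le_refl 0)
  have h := hs.sum_add_tsum_nat_add 6
  have hexp : HasSum (fun k : ℕ => (1 / 5040 : ℝ) * (5 ^ (k + 6) / (k + 6).factorial))
      (1 / 5040 * (Real.exp 5 - ∑ k ∈ Finset.range 6, (5 : ℝ) ^ k / k.factorial)) := by
    refine HasSum.mul_left _ ?_
    rw [hasSum_nat_add_iff' 6 (f := fun k : ℕ => (5 : ℝ) ^ k / k.factorial), Real.exp_eq_exp_ℝ]
    exact NormedSpace.expSeries_div_hasSum_exp (5 : ℝ)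
  have htail := tsum_of_norm_bounded hexp
    (f := fun k : ℕ => (-5 : ℝ) ^ (k + 6) * reducedBesselCoeff 0 (k + 6)) fun k => by
    rw [norm_mul, norm_pow, norm_neg, Real.norm_of_nonneg (by norm_num : (0 : ℝ) ≤ 5),
      Real.norm_of_nonneg (reducedBesselCoeff_pos le_rfl _).le, reducedBesselCoeff]
    have hprod : ∏ i ∈ Finset.range (k + 6), ((i : ℝ) + 1 + 0) = (k + 6).factorial := by
      rw [← Finset.prod_range_add_one_eq_factorial]
      push_cast
      simp
    have hfac : (5040 : ℝ) ≤ (k + 6 + 1).factorial := by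
      exact_mod_cast Nat.factorial_le (show 7 ≤ k + 6 + 1 by omega)
    rw [hprod, one_div_mul_eq_div, div_div, mul_one_div, mul_comm ((k + 6 + 1).factorial : ℝ)]
    gcongr
  have hexp5 : Real.exp 5 < 243 := by
    rw [show (5 : ℝ) = (5 : ℕ) * 1 by norm_num, Real.exp_nat_mul]
    calc Real.exp 1 ^ 5 < 3 ^ 5 := pow_lt_pow_left₀ Real.exp_one_lt_three (Real.exp_pos _).le
          (by norm_num)
      _ = 243 := by norm_num
  have htail' := (abs_le.1 htail).2
  have hneg : reducedBesselSeries 5 0 < 0 := by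
    rw [reducedBesselSeries, ← h]
    have hfin : ∑ k ∈ Finset.range 6, (-5 : ℝ) ^ k * reducedBesselCoeff 0 k < -1 / 10 := by
      simp only [Finset.sum_range_succ, Finset.sum_range_zero, reducedBesselCoeff_succ,
        reducedBesselCoeff_zero_index]
      norm_num
    have hpos : 0 ≤ ∑ k ∈ Finset.range 6, (5 : ℝ) ^ k / k.factorial :=
      Finset.sum_nonneg fun k _ => by positivity
    linarith
  simp only [reducedBessel]
  linarith

/-- For all small `s > 0` some order has zeros whose ratio is `√s`. -/
theorem eventually_exists_reducedBessel_eq_zero :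
    ∀ᶠ s : ℝ in 𝓝[>] 0, ∃ w μ : ℝ, 0 < w ∧ 0 < μ ∧
      reducedBessel w μ = 0 ∧ reducedBessel (s * w) μ = 0 := by
  obtain ⟨m, hm, hm0, hmz⟩ := exists_continuous_reducedBessel_eq_zero
  have hlim : ∀ w : ℝ, 0 < w →
      Tendsto (fun s => reducedBessel w (m (s * w))) (𝓝[>] 0) (𝓝 (reducedBessel w 0)) := by
    intro w hw
    have hc := continuousOn_reducedBessel (w, 0) ⟨hw.le, le_refl (0 : ℝ)⟩
    refine Tendsto.comp (g := fun p : ℝ × ℝ => reducedBessel p.1 p.2) hc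
      (f := fun s => (w, m (s * w))) (tendsto_nhdsWithin_iff.2 ⟨?_, ?_⟩)
    · have : Tendsto (fun s => (w, m (s * w))) (𝓝 0) (𝓝 (w, m (0 * w))) :=
        Continuous.tendsto (by fun_prop) 0
      rw [zero_mul, hm0] at this
      exact this.mono_left nhdsWithin_le_nhds
    · have : Iio (1 / 3 / w) ∈ 𝓝[>] (0 : ℝ) :=
        mem_nhdsWithin_of_mem_nhds (Iio_mem_nhds (by positivity))
      filter_upwards [this, self_mem_nhdsWithin] with s hs hs0
      have hs0 : 0 < s := hs0
      exact ⟨hw.le, (hmz _ ⟨by positivity, ((lt_div_iff₀ hw).1 hs).le⟩).1⟩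
  have h1 := (hlim (1 / 3) (by norm_num)).eventually_lt_const
    (reducedBessel_zero_right_neg (by norm_num) le_rfl)
  have h5 := (hlim 5 (by norm_num)).eventually_const_lt reducedBessel_five_zero_pos
  have hsmall : Iio (1 / 15 : ℝ) ∈ 𝓝[>] (0 : ℝ) :=
    mem_nhdsWithin_of_mem_nhds (Iio_mem_nhds (by norm_num))
  filter_upwards [h1, h5, hsmall, self_mem_nhdsWithin] with s h1 h5 hs hs0
  have hs0 : 0 < s := hs0
  have hs : s < 1 / 15 := hs
  -- With `μ = m (s * w)` the point `s * w` is automatically a zero; the sign change in `w` makes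
  -- `w` one too.
  have hmem : ∀ w ∈ Icc (1 / 3 : ℝ) 5, s * w ∈ Icc (0 : ℝ) (1 / 3) := fun w hw =>
    ⟨mul_nonneg hs0.le (by linarith [hw.1]), by nlinarith [hw.1, hw.2]⟩
  have hc : ContinuousOn (fun w => reducedBessel w (m (s * w))) (Icc (1 / 3) 5) :=
    continuousOn_reducedBessel.comp (f := fun w : ℝ => (w, m (s * w)))
      (Continuous.continuousOn (by fun_prop))
      fun w hw => ⟨by simp only [mem_Ici]; linarith [hw.1], (hmz _ (hmem w hw)).1⟩
  obtain ⟨w, hw, hw0⟩ := intermediate_value_Icc (by norm_num) hc ⟨h1.le, h5.le⟩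
  have hwpos : 0 < w := by linarith [hw.1]
  obtain ⟨hm1, hm2⟩ := hmz _ (hmem w hw)
  refine ⟨w, m (s * w), hwpos, lt_of_le_of_ne hm1 fun h => ?_, hw0, hm2⟩
  rw [← h] at hm2
  exact (reducedBessel_zero_right_neg (by positivity) (hmem w hw).2).ne hm2

/-! ### Return to the Bessel function and conclusion -/

theorem Gamma_natCast_add_one_add {μ : ℝ} (hμ : 0 < μ) (k : ℕ) :
    Complex.Gamma ((k : ℂ) + 1 + μ) =
      Complex.Gamma (1 + μ) * ((∏ i ∈ Finset.range k, ((i : ℝ) + 1 + μ) : ℝ) : ℂ) := by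
  induction k with
  | zero => simp
  | succ k ih =>
    have h : (k : ℂ) + 1 + μ ≠ 0 := by
      have : (k : ℝ) + 1 + μ ≠ 0 := by positivity
      exact_mod_cast this
    rw [Finset.prod_range_succ, show ((k + 1 : ℕ) : ℂ) + 1 + μ = (k + 1 + μ) + 1 by push_cast; ring,
      Complex.Gamma_add_one _ h, ih]
    push_cast
    ring

theorem Gamma_mul_besselj {x μ : ℝ} (hμ : 0 < μ) :
    Complex.Gamma (1 + μ) * besselj ((μ - 1 : ℝ) : ℂ) (x : ℂ) =
      (reducedBessel ((x / 2) ^ 2) μ : ℝ) := by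
  have hμ' : (μ : ℂ) ≠ 0 := by exact_mod_cast hμ.ne'
  have hG : Complex.Gamma (1 + μ) ≠ 0 :=
    Complex.Gamma_ne_zero_of_re_pos (by simp; linarith)
  obtain ⟨w, hw⟩ : ∃ w, w = (x / 2) ^ 2 := ⟨_, rfl⟩
  have hw0 : 0 ≤ w := hw ▸ sq_nonneg _
  rw [← hw]
  have hs := (summable_reducedBessel hw0 hμ.le).hasSum
  have hs' := (Complex.hasSum_ofReal.2 hs).mul_left (-(w : ℂ))
  rw [besselj, ← tsum_mul_left]
  refine HasSum.tsum_eq ?_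
  -- The term `k = 0` is split off: it equals `Γ(1 + μ) / Γ(μ) = μ`.
  rw [← hasSum_nat_add_iff' 1]
  have hterm : ∀ k : ℕ, Complex.Gamma (1 + μ) * ((-1 : ℂ) ^ (k + 1) / (((k + 1).factorial : ℂ) *
      Complex.Gamma (((k + 1 : ℕ) : ℂ) + ((μ - 1 : ℝ) : ℂ) + 1)) * ((x : ℂ) / 2) ^ (2 * (k + 1))) =
      -(w : ℂ) * (((-w) ^ k * reducedBesselCoeff μ k : ℝ) : ℂ) := by
    intro k
    have e : ((k + 1 : ℕ) : ℂ) + ((μ - 1 : ℝ) : ℂ) + 1 = k + 1 + μ := by push_cast; ring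
    have hprod : ((∏ i ∈ Finset.range k, ((i : ℝ) + 1 + μ) : ℝ) : ℂ) ≠ 0 := by
      have := one_le_prod_range_add hμ.le k
      exact_mod_cast (by positivity : ∏ i ∈ Finset.range k, ((i : ℝ) + 1 + μ) ≠ 0)
    have hf : ((k + 1).factorial : ℂ) ≠ 0 := by exact_mod_cast Nat.factorial_ne_zero _
    have hwc : ((x : ℂ) / 2) ^ (2 * (k + 1)) = (w : ℂ) ^ (k + 1) := by
      rw [pow_mul, hw]
      push_cast
      rfl
    rw [e, Gamma_natCast_add_one_add hμ, hwc, Complex.ofReal_mul, reducedBesselCoeff,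
      Complex.ofReal_pow, Complex.ofReal_neg, Complex.ofReal_div, Complex.ofReal_mul,
      Complex.ofReal_natCast, Complex.ofReal_one]
    rw [neg_pow (w : ℂ) k]
    field_simp
    ring
  have hGμ : Complex.Gamma (1 + μ) = μ * Complex.Gamma μ := by
    rw [add_comm, Complex.Gamma_add_one _ hμ']
  have hG0 : Complex.Gamma μ ≠ 0 := fun h => hG (by rw [hGμ, h, mul_zero])
  simp only [hterm]
  suffices hval : (reducedBessel w μ : ℂ) - ∑ i ∈ Finset.range 1, Complex.Gamma (1 + μ) *
      ((-1 : ℂ) ^ i / ((i.factorial : ℂ) * Complex.Gamma ((i : ℂ) + ((μ - 1 : ℝ) : ℂ) + 1)) *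
        ((x : ℂ) / 2) ^ (2 * i)) = -(w : ℂ) * (reducedBesselSeries w μ : ℝ) by
    rw [hval]
    exact hs'
  rw [Finset.sum_range_one, reducedBessel, hGμ,
    show ((0 : ℕ) : ℂ) + ((μ - 1 : ℝ) : ℂ) + 1 = μ by push_cast; ring]
  push_cast
  field_simp
  simp

theorem exists_besselLiouvilleSet_ne_classical :
    ∃ ν : ℝ, (∀ n : ℕ, ν ≠ -((n : ℝ) + 1)) ∧
      besselLiouvilleSet (ν : ℂ) ≠ classicalLiouvilleSet := by
  -- A ratio `L` of zeros in `z` is a ratio `L ^ 2` in `w`.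
  have hlim : Tendsto (fun L : ℝ => L ^ 2) (𝓝[>] 0) (𝓝[>] 0) := by
    refine tendsto_nhdsWithin_iff.2 ⟨?_, ?_⟩
    · have : Tendsto (fun L : ℝ => L ^ 2) (𝓝 0) (𝓝 (0 ^ 2)) := Continuous.tendsto (by fun_prop) 0
      rw [zero_pow two_ne_zero] at this
      exact this.mono_left nhdsWithin_le_nhds
    · filter_upwards [self_mem_nhdsWithin] with L hL
      exact pow_pos (mem_Ioi.1 hL) 2
  obtain ⟨ε, hε, hev⟩ := mem_nhdsGT_iff_exists_Ioo_subset.1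
    (hlim.eventually eventually_exists_reducedBessel_eq_zero)
  obtain ⟨L, hLε, hL⟩ := dense_liouville.exists_mem_open isOpen_Ioo (nonempty_Ioo.2 hε) |>.imp
    fun _ h => h.symm
  obtain ⟨w, μ, hw, hμ, hz1, hz2⟩ := hev hLε
  have hL0 : 0 < L := hLε.1
  refine ⟨μ - 1, fun n h => ?_, fun h => ?_⟩
  · have : (0 : ℝ) ≤ n := by positivity
    linarith
  have hG : Complex.Gamma (1 + μ) ≠ 0 :=
    Complex.Gamma_ne_zero_of_re_pos (by simp; linarith)
  have hzero : ∀ x : ℝ, reducedBessel ((x / 2) ^ 2) μ = 0 →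
      besselj ((μ - 1 : ℝ) : ℂ) (x : ℂ) = 0 := fun x hx => by
    have := Gamma_mul_besselj (x := x) hμ
    rw [hx, Complex.ofReal_zero, mul_eq_zero] at this
    exact this.resolve_left hG
  have hmem : (L : ℂ) ∈ besselLiouvilleSet ((μ - 1 : ℝ) : ℂ) := by
    rw [h]
    exact ⟨L, hL, rfl⟩
  have hsq : 0 < √w := Real.sqrt_pos.2 hw
  have hne : ((2 * √w : ℝ) : ℂ) ≠ 0 := by
    exact_mod_cast (by positivity : 2 * √w ≠ 0)
  refine hmem.1 ⟨by exact_mod_cast hL0.ne', ((L * (2 * √w) : ℝ) : ℂ), ((2 * √w : ℝ) : ℂ),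
    hzero _ ?_, hzero _ ?_, hne, ?_⟩
  · rw [show (L * (2 * √w) / 2) ^ 2 = L ^ 2 * √w ^ 2 by ring, Real.sq_sqrt hw.le]
    exact hz2
  · rw [show (2 * √w / 2) ^ 2 = √w ^ 2 by ring, Real.sq_sqrt hw.le]
    exact hz1
  · rw [Complex.ofReal_mul L, mul_div_cancel_right₀ _ hne]

theorem mainTheorem10 :
    (∀ ν : ℂ, (∀ n : ℕ, ν ≠ -((n : ℂ) + 1)) →
      ∃ ν' : ℝ, (∀ n : ℕ, ν' ≠ -((n : ℝ) + 1)) ∧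
        besselLiouvilleSet ν ≠ besselLiouvilleSet (ν' : ℂ)) ∧
    besselLiouvilleSet (1 / 2) = classicalLiouvilleSet ∧
    (∃ ν' : ℝ, (∀ n : ℕ, ν' ≠ -((n : ℝ) + 1)) ∧
      besselLiouvilleSet (ν' : ℂ) ≠ classicalLiouvilleSet) := by
  refine ⟨fun ν _ => ?_, besselLiouvilleSet_half, exists_besselLiouvilleSet_ne_classical⟩
  by_cases h : besselLiouvilleSet ν = classicalLiouvilleSet
  · obtain ⟨ν', hν', hne⟩ := exists_besselLiouvilleSet_ne_classical
    exact ⟨ν', hν', fun h' => hne (h'.symm.trans h)⟩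
  · refine ⟨1 / 2, fun n hn => ?_, fun h' => h ?_⟩
    · have : (0 : ℝ) ≤ n := by positivity
      linarith
    · rw [h', ← besselLiouvilleSet_half]
      push_cast
      rfl
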